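/- Let $R$ be an associative ring with unity. A left $R$-module $M$ is called Gorenstein projective (respectively Ding projective) if it is isomorphic to a cycle module of an unbounded exact complex $P$ of projective left $R$-modules such that $\mathrm{Hom}_R(P,Q)$ is exact for every projective (respectively, every flat) left $R$-module $Q$. It is called projectively coresolved Gorenstein flat if it is isomorphic to a cycle module of an unbounded exact complex $P$ of projective left $R$-modules such that $I\otimes_R P$ is exact for every injective right $R$-module $I$. Write $\mathcal{GP}$, $\mathcal{DP}$ and $\mathcal{PGF}$ for these three classes of left $R$-modules. Suppose that every injective right $R$-module $I$ has finite flat dimension (that is, for some $n\ge 0$, which may depend on $I$, there is an exact sequence $0\to F_n\to\cdots\to F_0\to I\to 0$ of right $R$-modules with all $F_i$ flat). Then $\mathcal{GP}=\mathcal{DP}=\mathcal{PGF}$. -/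

import Mathlib

universe u

open CategoryTheory
open scoped TensorProduct

/-! Left `R`-modules are `Module R M`; right `R`-modules are `Module Rᵐᵒᵖ A`, where
`MulOpposite.op r • a` is `a r`. Modules have the same universe level as the ring. -/

section Tensor

/-- The subgroup of `A ⊗_ℤ M` generated by all `(a r) ⊗ m - a ⊗ (r m)`. -/
def balancedRelations (R : Type u) [Ring R] (A M : Type u) [AddCommGroup A] [Module Rᵐᵒᵖ A]
    [AddCommGroup M] [Module R M] : AddSubgroup (A ⊗[ℤ] M) :=
  AddSubgroup.closure {t | ∃ (a : A) (r : R) (m : M),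
    t = (MulOpposite.op r • a) ⊗ₜ[ℤ] m - a ⊗ₜ[ℤ] (r • m)}

/-- The tensor product `A ⊗_R M` of a right `R`-module `A` and a left `R`-module `M` over an
arbitrary (not necessarily commutative) ring `R`, as an abelian group. -/
abbrev BalancedTensor (R : Type u) [Ring R] (A M : Type u) [AddCommGroup A] [Module Rᵐᵒᵖ A]
    [AddCommGroup M] [Module R M] : Type u :=
  (A ⊗[ℤ] M) ⧸ balancedRelations R A M

/-- The homomorphism of abelian groups `g ⊗_R f : A ⊗_R M → B ⊗_R N`. -/
noncomputable def BalancedTensor.map {R : Type u} [Ring R] {A B M N : Type u}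
    [AddCommGroup A] [Module Rᵐᵒᵖ A] [AddCommGroup B] [Module Rᵐᵒᵖ B]
    [AddCommGroup M] [Module R M] [AddCommGroup N] [Module R N]
    (g : A →ₗ[Rᵐᵒᵖ] B) (f : M →ₗ[R] N) :
    BalancedTensor R A M →+ BalancedTensor R B N :=
  QuotientAddGroup.map (balancedRelations R A M) (balancedRelations R B N)
    (TensorProduct.map g.toAddMonoidHom.toIntLinearMap
      f.toAddMonoidHom.toIntLinearMap).toAddMonoidHom (by
    refine (AddSubgroup.closure_le _).2 ?_
    rintro _ ⟨a, r, m, rfl⟩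
    refine AddSubgroup.subset_closure ⟨g a, r, f m, ?_⟩
    simp)

end Tensor

section Flat

/-- A left `R`-module `F` is flat: `- ⊗_R F` preserves injectivity. -/
def IsFlatLeft (R : Type u) [Ring R] (F : Type u) [AddCommGroup F] [Module R F] : Prop :=
  ∀ (A B : Type u) [AddCommGroup A] [Module Rᵐᵒᵖ A] [AddCommGroup B] [Module Rᵐᵒᵖ B]
    (g : A →ₗ[Rᵐᵒᵖ] B), Function.Injective g →
    Function.Injective (BalancedTensor.map g (LinearMap.id : F →ₗ[R] F))

/-- A right `R`-module `F` is flat: `F ⊗_R -` preserves injectivity. -/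
def IsFlatRight (R : Type u) [Ring R] (F : Type u) [AddCommGroup F] [Module Rᵐᵒᵖ F] : Prop :=
  ∀ (M N : Type u) [AddCommGroup M] [Module R M] [AddCommGroup N] [Module R N]
    (f : M →ₗ[R] N), Function.Injective f →
    Function.Injective (BalancedTensor.map (LinearMap.id : F →ₗ[Rᵐᵒᵖ] F) f)

/-- The right `R`-module `A` has flat dimension at most `n`, that is, there is an exact sequence
`0 → F_n → ⋯ → F_0 → A → 0` of right `R`-modules with all `F_i` flat; the sequence is unfolded
one step at a time, replacing `A` by the kernel of `F_0 → A`. -/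
def RightFlatDimLE (R : Type u) [Ring R] :
    (n : ℕ) → (A : Type u) → [AddCommGroup A] → [Module Rᵐᵒᵖ A] → Prop
  | 0, A, _, _ => IsFlatRight R A
  | n + 1, A, _, _ =>
      ∃ (F : Type u) (_ : AddCommGroup F) (_ : Module Rᵐᵒᵖ F) (p : F →ₗ[Rᵐᵒᵖ] A),
        IsFlatRight R F ∧ Function.Surjective p ∧ RightFlatDimLE R n (LinearMap.ker p)

end Flat

section Classes

/-- An exact (unbounded) complex `⋯ → X (i+1) → X i → X (i-1) → ⋯` of projective
left `R`-modules. -/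
structure IsExactProjectiveComplex {R : Type u} [Ring R]
    (P : ChainComplex (ModuleCat.{u} R) ℤ) : Prop where
  projective : ∀ i : ℤ, Module.Projective R (P.X i)
  exact : ∀ i : ℤ, Function.Exact (P.d (i + 1) i).hom (P.d i (i - 1)).hom

/-- The complex of abelian groups `Hom_R(P, N)` is exact. -/
def IsHomExact {R : Type u} [Ring R] (P : ChainComplex (ModuleCat.{u} R) ℤ)
    (N : Type u) [AddCommGroup N] [Module R N] : Prop :=
  ∀ i : ℤ, Function.Exact
    (fun g : P.X (i - 1) →ₗ[R] N => g ∘ₗ (P.d i (i - 1)).hom)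
    (fun g : P.X i →ₗ[R] N => g ∘ₗ (P.d (i + 1) i).hom)

/-- The complex of abelian groups `A ⊗_R P` is exact. -/
def IsTensorExact {R : Type u} [Ring R] (P : ChainComplex (ModuleCat.{u} R) ℤ)
    (A : Type u) [AddCommGroup A] [Module Rᵐᵒᵖ A] : Prop :=
  ∀ i : ℤ, Function.Exact
    (BalancedTensor.map (LinearMap.id : A →ₗ[Rᵐᵒᵖ] A) (P.d (i + 1) i).hom)
    (BalancedTensor.map (LinearMap.id : A →ₗ[Rᵐᵒᵖ] A) (P.d i (i - 1)).hom)

/-- `M` is (isomorphic to) one of the cycle modules of the complex `P`. -/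
def IsCycleOf {R : Type u} [Ring R] (M : ModuleCat.{u} R)
    (P : ChainComplex (ModuleCat.{u} R) ℤ) : Prop :=
  ∃ i : ℤ, Nonempty (M ≃ₗ[R] LinearMap.ker (P.d i (i - 1)).hom)

/-- The class of Gorenstein projective left `R`-modules. -/
def GorensteinProjective (R : Type u) [Ring R] : ObjectProperty (ModuleCat.{u} R) := fun M =>
  ∃ P : ChainComplex (ModuleCat.{u} R) ℤ, IsExactProjectiveComplex P ∧
    (∀ (Q : Type u) [AddCommGroup Q] [Module R Q], Module.Projective R Q → IsHomExact P Q) ∧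
    IsCycleOf M P

/-- The class of Ding projective left `R`-modules. -/
def DingProjective (R : Type u) [Ring R] : ObjectProperty (ModuleCat.{u} R) := fun M =>
  ∃ P : ChainComplex (ModuleCat.{u} R) ℤ, IsExactProjectiveComplex P ∧
    (∀ (F : Type u) [AddCommGroup F] [Module R F], IsFlatLeft R F → IsHomExact P F) ∧
    IsCycleOf M P

/-- The class of projectively coresolved Gorenstein flat left `R`-modules. -/
def ProjectivelyCoresolvedGorensteinFlat (R : Type u) [Ring R] :
    ObjectProperty (ModuleCat.{u} R) := fun M =>
  ∃ P : ChainComplex (ModuleCat.{u} R) ℤ, IsExactProjectiveComplex P ∧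
    (∀ (I : Type u) [AddCommGroup I] [Module Rᵐᵒᵖ I],
      Module.Injective Rᵐᵒᵖ I → IsTensorExact P I) ∧
    IsCycleOf M P

end Classes

/-! Write `X⁺` for the character module of `X`. Projective modules are flat, so Ding projective
implies Gorenstein projective. The other two inclusions keep the complex `P` and compare exactness
conditions, using that `A ⊗ P` is exact iff `Hom(P, A⁺)` is (`isTensorExact_iff_isHomExact`).

Gorenstein projective implies PGF: if `A` is flat then `A⁺` is injective, so `Hom(P, A⁺)` is exact
for every exact `P`. Dualizing `0 → K → F → A → 0` and shifting dimension extends this to finite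
flat dimension, hence to all injective `A` under the hypothesis.

PGF implies Ding projective without any condition on the ring. Let `F` be flat. Iterating the pure
embedding `N → N⁺⁺` and its cokernel gives a pure coresolution of `F` whose terms have the form
`N⁺⁺`. A cocycle `g` with values in `F` extends to a chain map from `P` to this coresolution once
`Hom(P, N⁺⁺)` is exact, and a chain map from projectives to a pure exact complex is null-homotopic
(`exists_homotopy_of_projective`); the homotopy writes `g` as a coboundary.

For the exactness of `Hom(P, N⁺⁺)`, equivalently of `N⁺ ⊗ P`, note that `F⁺` is injective, but the
later `N⁺` need not be. Exactness is therefore encoded by implications between finite linear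
systems. Since products of injectives are injective, one family of implications serves all
injectives (`exists_boundsOn_of_injective`). Such implications pass between a module and its dual,
and to the cokernel of `N → N⁺⁺` (`leftImp_coeval`), hence along the whole coresolution. -/

open MulOpposite (op unop)

/-! ### Characters of abelian groups and of modules -/

namespace CharacterModule

section Abelian

variable {T U V W : Type*} [AddCommGroup T] [AddCommGroup U] [AddCommGroup V] [AddCommGroup W]

/-- A character killing the kernel of `α` factors through `α`. -/
lemma exists_comp_eq_of_ker_le (α : U →+ V) (χ : CharacterModule U)
    (h : ∀ u, α u = 0 → χ u = 0) : ∃ v : CharacterModule V, ∀ u, v (α u) = χ u := by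
  let q : U ⧸ α.ker →+ V := QuotientAddGroup.kerLift α
  let χ' : CharacterModule (U ⧸ α.ker) :=
    QuotientAddGroup.lift α.ker (χ : U →+ AddCircle (1 : ℚ)) fun u hu => h u hu
  obtain ⟨v, hv⟩ := dual_surjective_of_injective q.toIntLinearMap
    (QuotientAddGroup.kerLift_injective α) χ'
  exact ⟨v, fun u => DFunLike.congr_fun hv (QuotientAddGroup.mk u)⟩

/-- Characters separate elements from subgroups. -/
lemma exists_ne_zero_of_notMem_range (β : T →+ W) {w : W} (h : w ∉ Set.range β) :
    ∃ χ : CharacterModule W, (∀ t, χ (β t) = 0) ∧ χ w ≠ 0 := by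
  have hw : (QuotientAddGroup.mk w : W ⧸ β.range) ≠ 0 := by
    rw [Ne, QuotientAddGroup.eq_zero_iff]
    exact h
  obtain ⟨c, hc⟩ := exists_character_apply_ne_zero_of_ne_zero hw
  refine ⟨AddMonoidHom.comp c (QuotientAddGroup.mk' β.range), fun t => ?_, hc⟩
  have : (QuotientAddGroup.mk (β t) : W ⧸ β.range) = 0 :=
    (QuotientAddGroup.eq_zero_iff _).2 ⟨t, rfl⟩
  exact (congrArg c this).trans (map_zero c)

/-- An implication between existence conditions on abelian groups holds if and only if the dual
implication holds for characters. -/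
lemma forall_exists_iff_dual (α : U →+ V) (ε : U →+ W) (β : T →+ W) :
    (∀ u, α u = 0 → ∃ t, β t = ε u) ↔
      ∀ w : CharacterModule W, (∀ t, w (β t) = 0) →
        ∃ v : CharacterModule V, ∀ u, v (α u) = w (ε u) := by
  -- Both sides say that `ε` maps `ker α` into `range β`. One direction uses that `ℚ/ℤ` is
  -- injective, the other that it is a cogenerator.
  constructor
  · intro h w hw
    refine exists_comp_eq_of_ker_le α (AddMonoidHom.comp w ε) fun u hu => ?_
    obtain ⟨t, ht⟩ := h u hu
    exact (congrArg w ht).symm.trans (hw t)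
  · intro h u hu
    by_contra hne
    obtain ⟨χ, hχ, hχu⟩ := exists_ne_zero_of_notMem_range β (w := ε u) hne
    obtain ⟨v, hv⟩ := h χ hχ
    exact hχu (by rw [← hv, hu, map_zero])

@[simp] lemma add_apply' (c c' : CharacterModule U) (x : U) : (c + c') x = c x + c' x := rfl

@[simp] lemma zero_apply' (x : U) : (0 : CharacterModule U) x = 0 := rfl

lemma sum_apply' {ι : Type*} (s : Finset ι) (c : ι → CharacterModule U) (x : U) :
    (∑ i ∈ s, c i) x = ∑ i ∈ s, c i x := by
  classical
  induction s using Finset.induction_on with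
  | empty => simp
  | insert a s ha ih => simp [Finset.sum_insert ha, ih]

/-- The character of a finite power given by a tuple of characters. -/
def ofPi {ι : Type*} [Fintype ι] (c : ι → CharacterModule U) : CharacterModule (ι → U) :=
  AddMonoidHom.mk' (fun x => ∑ i, c i (x i)) fun x y => by
    simp [Finset.sum_add_distrib]

lemma ofPi_apply {ι : Type*} [Fintype ι] (c : ι → CharacterModule U) (x : ι → U) :
    ofPi c x = ∑ i, c i (x i) := rfl

lemma ofPi_surjective {ι : Type*} [Fintype ι] (χ : CharacterModule (ι → U)) :
    ∃ c : ι → CharacterModule U, ofPi c = χ := by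
  classical
  refine ⟨fun i => AddMonoidHom.comp χ (AddMonoidHom.single (fun _ : ι => U) i), ?_⟩
  ext x
  have hx : x = ∑ i, Pi.single i (x i) := (Finset.univ_sum_single x).symm
  conv_rhs => rw [hx, map_sum]
  rfl

lemma ofPi_injective {ι : Type*} [Fintype ι] :
    Function.Injective (ofPi : (ι → CharacterModule U) → CharacterModule (ι → U)) := by
  classical
  intro c c' h
  funext i
  ext x
  have := DFunLike.congr_fun h (Pi.single i x)
  rw [ofPi_apply, ofPi_apply, Finset.sum_eq_single i, Finset.sum_eq_single i] at this
  · simpa using this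
  all_goals simp +contextual

end Abelian

variable {R : Type u} [Ring R]

/-- The character module of a left module is a right module. -/
instance rightModule (M : Type u) [AddCommGroup M] [Module R M] :
    Module Rᵐᵒᵖ (CharacterModule M) where
  smul r c := AddMonoidHom.comp c (DistribSMul.toAddMonoidHom M r.unop)
  one_smul c := by ext x; exact congrArg c (one_smul R x)
  mul_smul r s c := by ext x; exact congrArg c (mul_smul s.unop r.unop x)
  smul_zero r := rfl
  smul_add r c c' := rfl
  add_smul r s c := by
    ext x; exact (congrArg c (add_smul r.unop s.unop x)).trans (map_add c _ _)
  zero_smul c := by ext x; exact (congrArg c (zero_smul R x)).trans (map_zero c)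

/-- The character module of a right module is a left module. -/
instance leftModule (A : Type u) [AddCommGroup A] [Module Rᵐᵒᵖ A] :
    Module R (CharacterModule A) where
  smul r c := AddMonoidHom.comp c (DistribSMul.toAddMonoidHom A (op r))
  one_smul c := by ext x; exact congrArg c (one_smul Rᵐᵒᵖ x)
  mul_smul r s c := by ext x; exact congrArg c (mul_smul (op s) (op r) x)
  smul_zero r := rfl
  smul_add r c c' := rfl
  add_smul r s c := by
    ext x; exact (congrArg c (add_smul (op r) (op s) x)).trans (map_add c _ _)
  zero_smul c := by ext x; exact (congrArg c (zero_smul Rᵐᵒᵖ x)).trans (map_zero c)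

/-- The evaluation map of a left module into its double character module. -/
def eval (R : Type u) [Ring R] (M : Type u) [AddCommGroup M] [Module R M] :
    M →ₗ[R] CharacterModule (CharacterModule M) where
  toFun x := AddMonoidHom.mk' (fun c : CharacterModule M => c x) fun _ _ => rfl
  map_add' x y := by ext c; exact map_add c x y
  map_smul' r x := rfl

end CharacterModule

/-! ### Balanced tensor products and the Hom-tensor adjunction -/

namespace BalancedTensor

variable {R : Type u} [Ring R] {A B M N : Type u}
  [AddCommGroup A] [Module Rᵐᵒᵖ A] [AddCommGroup B] [Module Rᵐᵒᵖ B]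
  [AddCommGroup M] [Module R M] [AddCommGroup N] [Module R N]

/-- The pure tensor `a ⊗ m`. -/
def tmul (R : Type u) [Ring R] {A M : Type u} [AddCommGroup A] [Module Rᵐᵒᵖ A]
    [AddCommGroup M] [Module R M] (a : A) (m : M) : BalancedTensor R A M :=
  QuotientAddGroup.mk (a ⊗ₜ[ℤ] m)

lemma add_tmul (a b : A) (m : M) : tmul R (a + b) m = tmul R a m + tmul R b m :=
  congrArg (QuotientAddGroup.mk' (balancedRelations R A M)) (TensorProduct.add_tmul a b m)

lemma tmul_add (a : A) (m n : M) : tmul R a (m + n) = tmul R a m + tmul R a n :=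
  congrArg (QuotientAddGroup.mk' (balancedRelations R A M)) (TensorProduct.tmul_add a m n)

lemma smul_tmul (r : R) (a : A) (m : M) : tmul R (op r • a) m = tmul R a (r • m) := by
  refine (sub_eq_zero.1 ?_)
  exact (QuotientAddGroup.eq_zero_iff _).2 (AddSubgroup.subset_closure ⟨a, r, m, rfl⟩)

/-- `tmul` as a biadditive map. -/
def mk (R : Type u) [Ring R] (A M : Type u) [AddCommGroup A] [Module Rᵐᵒᵖ A]
    [AddCommGroup M] [Module R M] : A →+ M →+ BalancedTensor R A M :=
  AddMonoidHom.mk' (fun a => AddMonoidHom.mk' (tmul R a) (tmul_add a)) fun a b => by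
    ext m; exact add_tmul a b m

lemma tmul_zero (a : A) : tmul R a (0 : M) = 0 := map_zero (mk R A M a)

lemma zero_tmul (m : M) : tmul R (0 : A) m = 0 := map_zero ((mk R A M).flip m)

lemma tmul_sum {ι : Type*} (s : Finset ι) (a : A) (m : ι → M) :
    tmul R a (∑ i ∈ s, m i) = ∑ i ∈ s, tmul R a (m i) := map_sum (mk R A M a) _ _

/-- Additive maps out of the tensor product from balanced biadditive maps. -/
def lift {X : Type*} [AddCommGroup X] (f : A →+ M →+ X)
    (hf : ∀ a (r : R) m, f (op r • a) m = f a (r • m)) : BalancedTensor R A M →+ X :=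
  QuotientAddGroup.lift (balancedRelations R A M)
    (TensorProduct.liftAddHom f fun (n : ℤ) a m => by simp) <| by
      refine (AddSubgroup.closure_le _).2 ?_
      rintro _ ⟨a, r, m, rfl⟩
      simp [hf, AddMonoidHom.mem_ker]

@[simp] lemma lift_tmul {X : Type*} [AddCommGroup X] (f : A →+ M →+ X)
    (hf : ∀ a (r : R) m, f (op r • a) m = f a (r • m)) (a : A) (m : M) :
    lift f hf (tmul R a m) = f a m :=
  rfl

lemma addHom_ext {X : Type*} [AddCommGroup X] {f g : BalancedTensor R A M →+ X}
    (h : ∀ a m, f (tmul R a m) = g (tmul R a m)) : f = g := by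
  refine QuotientAddGroup.addMonoidHom_ext _ (AddMonoidHom.ext fun t => ?_)
  induction t using TensorProduct.induction_on with
  | zero => simp
  | tmul a m => exact h a m
  | add x y hx hy => rw [map_add, map_add, hx, hy]

/-- Every tensor is a finite sum of pure tensors with distinct right hand factors. -/
lemma exists_eq_sum (z : BalancedTensor R A M) :
    ∃ (s : Finset M) (x : s → A), z = ∑ m, tmul R (x m) m.1 := by
  classical
  suffices h : ∃ f : M →₀ A, z = f.sum fun m a => tmul R a m by
    obtain ⟨f, rfl⟩ := h
    exact ⟨f.support, fun m => f m.1, (Finset.sum_coe_sort f.support fun m => tmul R (f m) m).symm⟩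
  obtain ⟨t, rfl⟩ := QuotientAddGroup.mk_surjective z
  induction t using TensorProduct.induction_on with
  | zero => exact ⟨0, by simp⟩
  | tmul a m => exact ⟨Finsupp.single m a, by rw [Finsupp.sum_single_index (zero_tmul m)]; rfl⟩
  | add x y hx hy =>
    obtain ⟨f, hf⟩ := hx
    obtain ⟨g, hg⟩ := hy
    refine ⟨f + g, ?_⟩
    rw [Finsupp.sum_add_index' zero_tmul fun m a b => add_tmul a b m, ← hf, ← hg]
    rfl

/-- Linear maps into a character module give characters of the tensor product. -/
def toChar (g : M →ₗ[R] CharacterModule A) : CharacterModule (BalancedTensor R A M) :=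
  lift (AddMonoidHom.flip
      (AddMonoidHom.mk' (fun m => (g m : A →+ AddCircle (1 : ℚ))) fun m n => map_add g m n))
    fun a r m => (DFunLike.congr_fun (map_smul g r m) a).symm

lemma toChar_tmul (g : M →ₗ[R] CharacterModule A) (a : A) (m : M) :
    toChar g (tmul R a m) = g m a := lift_tmul _ _ a m

/-- Characters of the tensor product give linear maps into the character module. -/
def ofChar (c : CharacterModule (BalancedTensor R A M)) : M →ₗ[R] CharacterModule A where
  toFun m := AddMonoidHom.comp c ((mk R A M).flip m)
  map_add' m n := by ext a; exact (congrArg c (tmul_add a m n)).trans (map_add c _ _)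
  map_smul' r m := by ext a; exact congrArg c (smul_tmul r a m).symm

end BalancedTensor

open BalancedTensor

/-! ### Exactness of tensor and Hom under character duality -/

section Exactness

variable {R : Type u} [Ring R] {P Q S : Type u} [AddCommGroup P] [Module R P]
  [AddCommGroup Q] [Module R Q] [AddCommGroup S] [Module R S]

/-- Every map from the middle term to `N` that kills the image of `d` extends along `e`. -/
def HomExactAt (d : P →ₗ[R] Q) (e : Q →ₗ[R] S) (N : Type u) [AddCommGroup N] [Module R N] : Prop :=
  ∀ g : Q →ₗ[R] N, g ∘ₗ d = 0 → ∃ h : S →ₗ[R] N, h ∘ₗ e = g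

/-- After tensoring with `A`, the kernel of `e` is contained in the image of `d`. -/
def TensorExactAt (d : P →ₗ[R] Q) (e : Q →ₗ[R] S) (A : Type u) [AddCommGroup A]
    [Module Rᵐᵒᵖ A] : Prop :=
  ∀ z : BalancedTensor R A Q, map (LinearMap.id : A →ₗ[Rᵐᵒᵖ] A) e z = 0 →
    ∃ y, map (LinearMap.id : A →ₗ[Rᵐᵒᵖ] A) d y = z

/-- This is `forall_exists_iff_dual` with `ε` the identity, read through the adjunction `(A ⊗ M)⁺ ≅
Hom(M, A⁺)`. -/
lemma tensorExactAt_iff_homExactAt (d : P →ₗ[R] Q) (e : Q →ₗ[R] S) (A : Type u) [AddCommGroup A]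
    [Module Rᵐᵒᵖ A] : TensorExactAt d e A ↔ HomExactAt d e (CharacterModule A) := by
  have := CharacterModule.forall_exists_iff_dual (map (LinearMap.id : A →ₗ[Rᵐᵒᵖ] A) e)
    (AddMonoidHom.id _) (map (LinearMap.id : A →ₗ[Rᵐᵒᵖ] A) d)
  refine Iff.trans this ⟨fun H g hg => ?_, fun H w hw => ?_⟩
  · obtain ⟨v, hv⟩ := H (toChar g) fun t => by
      suffices h : AddMonoidHom.comp (toChar g) (map (LinearMap.id : A →ₗ[Rᵐᵒᵖ] A) d) = 0 from
        DFunLike.congr_fun h t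
      refine addHom_ext fun a m => ?_
      change toChar g (tmul R a (d m)) = 0
      rw [toChar_tmul]
      exact DFunLike.congr_fun (LinearMap.congr_fun hg m) a
    refine ⟨ofChar v, ?_⟩
    ext m a
    exact (hv (tmul R a m)).trans (toChar_tmul g a m)
  · obtain ⟨h, hh⟩ := H (ofChar w) (by ext m a; exact hw (tmul R a m))
    refine ⟨toChar h, fun u => ?_⟩
    suffices hc : AddMonoidHom.comp (toChar h) (map (LinearMap.id : A →ₗ[Rᵐᵒᵖ] A) e) = w from
      DFunLike.congr_fun hc u
    refine addHom_ext fun a m => ?_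
    change toChar h (tmul R a (e m)) = _
    rw [toChar_tmul]
    exact DFunLike.congr_fun (LinearMap.congr_fun hh m) a

/-- Lambek's criterion: a map `X → F⁺` is a character of `X ⊗ F`, and it extends along the injection
`X ⊗ F → Y ⊗ F` because `ℚ/ℤ` is divisible. -/
lemma injective_char_of_isFlatLeft {F : Type u} [AddCommGroup F] [Module R F]
    (hF : IsFlatLeft R F) : Module.Injective Rᵐᵒᵖ (CharacterModule F) where
  out X Y _ _ _ _ f hf g := by
    let c : CharacterModule (BalancedTensor R X F) :=
      lift (AddMonoidHom.mk' (fun x => (g x : F →+ AddCircle (1 : ℚ))) fun x y => map_add g x y)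
        fun a r m => DFunLike.congr_fun (map_smul g (op r) a) m
    obtain ⟨v, hv⟩ := CharacterModule.exists_comp_eq_of_ker_le
      (map f (LinearMap.id : F →ₗ[R] F)) c fun u hu => by
        rw [(injective_iff_map_eq_zero _).1 (hF X Y f hf) u hu, map_zero]
    refine ⟨{ toFun := fun y => AddMonoidHom.comp v (mk R Y F y)
              map_add' := fun y z => by
                ext m; exact (congrArg v (add_tmul y z m)).trans (map_add v _ _)
              map_smul' := fun r y => by ext m; exact congrArg v (smul_tmul r.unop y m) },
      fun x => ?_⟩
    ext m
    exact (hv (tmul R x m)).trans (lift_tmul _ _ _ _)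

lemma injective_char_of_isFlatRight {F : Type u} [AddCommGroup F] [Module Rᵐᵒᵖ F]
    (hF : IsFlatRight R F) : Module.Injective R (CharacterModule F) where
  out X Y _ _ _ _ f hf g := by
    obtain ⟨v, hv⟩ := CharacterModule.exists_comp_eq_of_ker_le
      (map (LinearMap.id : F →ₗ[Rᵐᵒᵖ] F) f) (toChar g) fun u hu => by
        rw [(injective_iff_map_eq_zero _).1 (hF X Y f hf) u hu, map_zero]
    refine ⟨ofChar v, fun x => ?_⟩
    ext a
    exact (hv (tmul R a x)).trans (toChar_tmul g a x)

end Exactness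

/-! ### Coordinates on tensor products with projective modules -/

section Projective

variable {R : Type u} [Ring R] {A B P Q S : Type u} [AddCommGroup A] [Module Rᵐᵒᵖ A]
  [AddCommGroup B] [Module Rᵐᵒᵖ B] [AddCommGroup P] [Module R P]
  [AddCommGroup Q] [Module R Q] [AddCommGroup S] [Module R S]

namespace BalancedTensor

/-- Coordinates of a tensor with respect to coordinates on the left module. -/
noncomputable def coord (A : Type u) [AddCommGroup A] [Module Rᵐᵒᵖ A] (σ : P →ₗ[R] (P →₀ R))
    (q : P) : BalancedTensor R A P →+ A :=
  lift (AddMonoidHom.mk' (fun a => AddMonoidHom.mk' (fun p => op (σ p q) • a) fun p p' => by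
      simp [add_smul]) fun a b => by ext p; simp)
    fun a r p => by simp [mul_smul]

lemma coord_tmul (σ : P →ₗ[R] (P →₀ R)) (q : P) (a : A) (p : P) :
    coord A σ q (tmul R a p) = op (σ p q) • a := lift_tmul _ _ a p

/-- Expanding each right-hand factor in the dual basis and regrouping gives `z = ∑ coord q z ⊗ q`.
Thus equality of tensors becomes a linear system over `A`. -/
lemma eq_zero_of_coord {σ : P →ₗ[R] (P →₀ R)}
    (hσ : Finsupp.linearCombination R id ∘ₗ σ = LinearMap.id) {z : BalancedTensor R A P}
    (hz : ∀ q, coord A σ q z = 0) : z = 0 := by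
  classical
  obtain ⟨s, x, rfl⟩ := exists_eq_sum z
  let t : Finset P := s.biUnion fun m => (σ m).support
  have key : ∀ m : s, tmul R (x m) m.1 = ∑ q ∈ t, tmul R (op (σ m q) • x m) q := fun m => by
    have h1 : (m : P) = ∑ q ∈ t, σ m q • q := by
      have h2 : (σ m).support ⊆ t := Finset.subset_biUnion_of_mem (fun m => (σ m).support) m.2
      have h3 : Finsupp.linearCombination R id (σ m) = (m : P) := LinearMap.congr_fun hσ m
      rw [Finsupp.linearCombination_apply, Finsupp.sum_of_support_subset _ h2 _ (by simp)] at h3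
      exact h3.symm
    conv_lhs => rw [h1, tmul_sum]
    exact Finset.sum_congr rfl fun q _ => (smul_tmul _ _ _).symm
  rw [Finset.sum_congr rfl fun m _ => key m, Finset.sum_comm]
  refine Finset.sum_eq_zero fun q _ => ?_
  have := hz q
  rw [map_sum] at this
  simp only [coord_tmul] at this
  have h4 := map_sum ((mk R A P).flip q) (fun m : s => op (σ m q) • x m) Finset.univ
  rw [this, map_zero] at h4
  exact h4.symm

lemma eq_of_coord {σ : P →ₗ[R] (P →₀ R)}
    (hσ : Finsupp.linearCombination R id ∘ₗ σ = LinearMap.id) {z w : BalancedTensor R A P}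
    (h : ∀ q, coord A σ q z = coord A σ q w) : z = w :=
  sub_eq_zero.1 (eq_zero_of_coord hσ fun q => by rw [map_sub, h, sub_self])

end BalancedTensor

lemma isFlatLeft_of_projective (hP : Module.Projective R P) : IsFlatLeft R P := by
  intro A B _ _ _ _ g hg
  obtain ⟨σ, hσ⟩ := Module.projective_def'.1 hP
  refine (injective_iff_map_eq_zero _).2 fun z hz => eq_zero_of_coord hσ fun q => hg ?_
  have : (g.toAddMonoidHom.comp (coord A σ q)) =
      (coord B σ q).comp (BalancedTensor.map g LinearMap.id) := by
    refine addHom_ext fun a m => ?_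
    change g (coord A σ q (tmul R a m)) = coord B σ q (tmul R (g a) m)
    rw [coord_tmul, coord_tmul, map_smul]
  rw [map_zero]
  exact (DFunLike.congr_fun this z).trans ((congrArg _ hz).trans (map_zero _))

end Projective

/-! ### Implications between finite linear systems and their duals -/

namespace Matrix

variable {R : Type u} [Ring R] {ι κ l m : Type*}

/-- A matrix acting from `Z ^ ι` to `Z ^ κ` for a right module `Z`. -/
def rightAct [Fintype ι] (A : Matrix κ ι R) (Z : Type u) [AddCommGroup Z] [Module Rᵐᵒᵖ Z] :
    (ι → Z) →+ (κ → Z) :=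
  AddMonoidHom.mk' (fun x k => ∑ i, op (A k i) • x i) fun x y => by
    funext k; simp [Finset.sum_add_distrib]

/-- A matrix acting from `N ^ κ` to `N ^ ι` for a left module `N`. -/
def leftAct [Fintype κ] (A : Matrix κ ι R) (N : Type u) [AddCommGroup N] [Module R N] :
    (κ → N) →+ (ι → N) :=
  AddMonoidHom.mk' (fun w i => ∑ k, A k i • w k) fun x y => by
    funext k; simp [Finset.sum_add_distrib]

lemma rightAct_apply [Fintype ι] (A : Matrix κ ι R) {Z : Type u} [AddCommGroup Z] [Module Rᵐᵒᵖ Z]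
    (x : ι → Z) (k : κ) : A.rightAct Z x k = ∑ i, op (A k i) • x i := rfl

lemma leftAct_apply [Fintype κ] (A : Matrix κ ι R) {N : Type u} [AddCommGroup N] [Module R N]
    (w : κ → N) (i : ι) : A.leftAct N w i = ∑ k, A k i • w k := rfl

open CharacterModule

variable [Fintype ι] [Fintype κ] [Fintype l] [Fintype m]

lemma ofPi_leftAct (A : Matrix κ ι R) {Z : Type u} [AddCommGroup Z] [Module Rᵐᵒᵖ Z]
    (c : κ → CharacterModule Z) (x : ι → Z) :
    ofPi (A.leftAct _ c) x = ofPi c (A.rightAct Z x) := by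
  simp only [ofPi_apply, leftAct_apply, rightAct_apply, sum_apply', map_sum]
  exact Finset.sum_comm

lemma ofPi_rightAct (A : Matrix κ ι R) {N : Type u} [AddCommGroup N] [Module R N]
    (c : ι → CharacterModule N) (w : κ → N) :
    ofPi (A.rightAct _ c) w = ofPi c (A.leftAct N w) := by
  simp only [ofPi_apply, leftAct_apply, rightAct_apply, sum_apply', map_sum]
  exact Finset.sum_comm

/-- The implication `A x = 0 → ∃ y, B y = E x` between systems of equations over a right module. -/
def RightImp (A : Matrix κ ι R) (E : Matrix l ι R) (B : Matrix l m R) (Z : Type u)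
    [AddCommGroup Z] [Module Rᵐᵒᵖ Z] : Prop :=
  ∀ x, A.rightAct Z x = 0 → ∃ y, B.rightAct Z y = E.rightAct Z x

/-- The implication `w B = 0 → ∃ v, v A = w E` between systems of equations over a left module. -/
def LeftImp (A : Matrix κ ι R) (E : Matrix l ι R) (B : Matrix l m R) (N : Type u)
    [AddCommGroup N] [Module R N] : Prop :=
  ∀ w, B.leftAct N w = 0 → ∃ v, A.leftAct N v = E.leftAct N w

variable {A : Matrix κ ι R} {E : Matrix l ι R} {B : Matrix l m R}

/-- Characters of a finite power are tuples of characters, and the dual of a matrix action is the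
action of the same matrix from the other side. -/
lemma rightImp_iff_leftImp_char {Z : Type u} [AddCommGroup Z] [Module Rᵐᵒᵖ Z] :
    RightImp A E B Z ↔ LeftImp A E B (CharacterModule Z) := by
  refine Iff.trans (forall_exists_iff_dual (A.rightAct Z) (E.rightAct Z) (B.rightAct Z))
    ⟨fun H w hw => ?_, fun H χ hχ => ?_⟩
  · obtain ⟨v, hv⟩ := H (ofPi w) fun t => by rw [← ofPi_leftAct, hw]; simp [ofPi_apply]
    obtain ⟨v, rfl⟩ := ofPi_surjective v
    exact ⟨v, ofPi_injective (by ext x; rw [ofPi_leftAct, hv, ofPi_leftAct])⟩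
  · obtain ⟨w, rfl⟩ := ofPi_surjective χ
    obtain ⟨v, hv⟩ := H w (ofPi_injective (by ext x; rw [ofPi_leftAct, hχ]; simp [ofPi_apply]))
    exact ⟨ofPi v, fun u => by rw [← ofPi_leftAct, hv, ofPi_leftAct]⟩

lemma leftImp_iff_rightImp_char {N : Type u} [AddCommGroup N] [Module R N] :
    LeftImp A E B N ↔ RightImp A E B (CharacterModule N) := by
  refine Iff.trans (forall_exists_iff_dual (B.leftAct N) (E.leftAct N) (A.leftAct N))
    ⟨fun H w hw => ?_, fun H χ hχ => ?_⟩
  · obtain ⟨v, hv⟩ := H (ofPi w) fun t => by rw [← ofPi_rightAct, hw]; simp [ofPi_apply]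
    obtain ⟨v, rfl⟩ := ofPi_surjective v
    exact ⟨v, ofPi_injective (by ext x; rw [ofPi_rightAct, hv, ofPi_rightAct])⟩
  · obtain ⟨w, rfl⟩ := ofPi_surjective χ
    obtain ⟨v, hv⟩ := H w (ofPi_injective (by ext x; rw [ofPi_rightAct, hχ]; simp [ofPi_apply]))
    exact ⟨ofPi v, fun u => by rw [← ofPi_rightAct, hv, ofPi_rightAct]⟩

/-- The evaluation map into the double character module is a pure monomorphism. -/
lemma exists_leftAct_eq_of_eval (A : Matrix κ ι R) {N : Type u} [AddCommGroup N] [Module R N]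
    (n : ι → N) (w : κ → CharacterModule (CharacterModule N))
    (h : A.leftAct _ w = fun i => eval R N (n i)) : ∃ v, A.leftAct N v = n := by
  -- A character `c` separating `n` from the image satisfies `A c = 0`, so `w A` vanishes on `c`;
  -- but `w A` is evaluation at `n`, which does not.
  by_contra hne
  obtain ⟨χ, hχ, hχn⟩ := exists_ne_zero_of_notMem_range (A.leftAct N) hne
  obtain ⟨c, rfl⟩ := ofPi_surjective χ
  have hc : A.rightAct _ c = 0 := ofPi_injective (by
    ext x; rw [ofPi_rightAct, hχ]; simp [ofPi_apply])
  have := ofPi_leftAct A w c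
  rw [hc, h, map_zero] at this
  exact hχn this

end Matrix

/-! ### Purity of the embedding into the double dual -/

namespace CharacterModule

variable {R : Type u} [Ring R]

/-- The cokernel of the evaluation map into the double character module. -/
abbrev Coeval (R : Type u) [Ring R] (N : Type u) [AddCommGroup N] [Module R N] : Type u :=
  CharacterModule (CharacterModule N) ⧸ LinearMap.range (eval R N)

lemma eval_injective (N : Type u) [AddCommGroup N] [Module R N] :
    Function.Injective (eval R N) :=
  (injective_iff_map_eq_zero _).2 fun _ hx =>
    eq_zero_of_character_apply fun c => DFunLike.congr_fun hx c

/-- Solutions of finite homogeneous systems lift from the cokernel of evaluation. -/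
lemma exists_lift_of_leftAct_eq_zero {ι κ : Type*} [Fintype ι] [Fintype κ] (A : Matrix κ ι R)
    {N : Type u} [AddCommGroup N] [Module R N] (w : κ → Coeval R N)
    (hw : A.leftAct _ w = 0) : ∃ v : κ → CharacterModule (CharacterModule N),
      A.leftAct _ v = 0 ∧ ∀ k, Submodule.Quotient.mk (v k) = w k := by
  choose v hv using fun k => Submodule.Quotient.mk_surjective _ (w k)
  have h1 : ∀ i, ∃ n, eval R N n = A.leftAct _ v i := fun i => by
    have : (LinearMap.range (eval R N)).mkQ (A.leftAct _ v i) = 0 := by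
      refine Eq.trans ?_ (congrFun hw i)
      rw [Matrix.leftAct_apply, map_sum, Matrix.leftAct_apply]
      refine Finset.sum_congr rfl fun k _ => ?_
      rw [map_smul, ← hv k]; rfl
    exact (Submodule.Quotient.mk_eq_zero _).1 this
  choose n hn using h1
  -- An arbitrary lift `v` solves the system only up to elements of `N`. Purity solves for this
  -- error inside `N`, and subtracting the solution does not change the class of `v`.
  obtain ⟨u, hu⟩ := A.exists_leftAct_eq_of_eval n v (funext fun i => (hn i).symm)
  refine ⟨fun k => v k - eval R N (u k), ?_, fun k => ?_⟩
  · funext i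
    have h2 := hn i
    rw [← hu, Matrix.leftAct_apply, Matrix.leftAct_apply, map_sum] at h2
    simp only [Matrix.leftAct_apply, smul_sub, Finset.sum_sub_distrib, ← h2, map_smul, sub_self,
      Pi.zero_apply]
  · rw [← hv k, Submodule.Quotient.eq]
    exact ⟨-u k, by simp⟩

/-- Dualizing twice carries the implication to `N⁺⁺`. Solutions of the premise lift there by purity,
and the resulting conclusion projects back to the cokernel. -/
lemma leftImp_coeval {ι κ l m : Type*} [Fintype ι] [Fintype κ] [Fintype l] [Fintype m]
    {A : Matrix κ ι R} {E : Matrix l ι R} {B : Matrix l m R}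
    {N : Type u} [AddCommGroup N] [Module R N] (h : Matrix.LeftImp A E B N) :
    Matrix.LeftImp A E B (Coeval R N) := by
  have h' := Matrix.rightImp_iff_leftImp_char.1 (Matrix.leftImp_iff_rightImp_char.1 h)
  intro w hw
  obtain ⟨w', hw', hww'⟩ := exists_lift_of_leftAct_eq_zero B w hw
  obtain ⟨v, hv⟩ := h' w' hw'
  refine ⟨fun k => (LinearMap.range (eval R N)).mkQ (v k), ?_⟩
  funext i
  have := congrArg (LinearMap.range (eval R N)).mkQ (congrFun hv i)
  simp only [Matrix.leftAct_apply, map_sum, map_smul] at this ⊢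
  rw [this]
  exact Finset.sum_congr rfl fun k _ => by rw [← hww' k]; rfl

end CharacterModule

/-! ### Uniform finite bounds for boundaries -/

section Compactness

variable {R : Type u} [Ring R] {P Q S : Type u} [AddCommGroup P] [Module R P]
  [AddCommGroup Q] [Module R Q] [AddCommGroup S] [Module R S]

/-- A finite set of rows outside of which the coordinates of finitely many elements vanish. -/
noncomputable def rowSupport [DecidableEq Q] {α : Type*} (σ : Q →ₗ[R] (Q →₀ R)) (s : Finset α)
    (f : α → Q) :
    Finset Q :=
  s.biUnion fun p => (σ (f p)).support

lemma apply_eq_zero_of_notMem_rowSupport [DecidableEq Q] {α : Type*} (σ : Q →ₗ[R] (Q →₀ R))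
    {s : Finset α} {f : α → Q} {q : Q} (hq : q ∉ rowSupport σ s f) (p : s) : σ (f p) q = 0 := by
  by_contra h
  exact hq (Finset.mem_biUnion.2 ⟨p, p.2, Finsupp.mem_support_iff.2 h⟩)

/-- The matrix of coordinates of the elements `f p`, `p ∈ s`, on the rows `t`. -/
noncomputable def coordMatrix {α : Type*} (σ : Q →ₗ[R] (Q →₀ R)) (s : Finset α) (f : α → Q) (t : Finset Q) :
    Matrix t s R := Matrix.of fun q p => σ (f p) q

lemma coord_sum_tmul {α : Type*} (σ : Q →ₗ[R] (Q →₀ R)) (s : Finset α) (f : α → Q) (q : Q)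
    {A : Type u} [AddCommGroup A] [Module Rᵐᵒᵖ A] (x : s → A) :
    coord A σ q (∑ p : s, tmul R (x p) (f p)) = ∑ p : s, op (σ (f p) q) • x p := by
  simp [map_sum, coord_tmul]

/-- Equality of tensors expressed by coordinates. -/
lemma sum_tmul_eq_iff [DecidableEq Q] {σ : Q →ₗ[R] (Q →₀ R)}
    (hσ : Finsupp.linearCombination R id ∘ₗ σ = LinearMap.id) {α β : Type*} (s : Finset α)
    (f : α → Q) (t : Finset β) (g : β → Q) (r : Finset Q) (hs : rowSupport σ s f ⊆ r)
    (ht : rowSupport σ t g ⊆ r) {A : Type u} [AddCommGroup A] [Module Rᵐᵒᵖ A]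
    (x : s → A) (y : t → A) :
    ∑ p : s, tmul R (x p) (f p) = ∑ p : t, tmul R (y p) (g p) ↔
      (coordMatrix σ s f r).rightAct A x = (coordMatrix σ t g r).rightAct A y := by
  constructor
  · intro h
    funext q
    have := congrArg (coord A σ q.1) h
    rw [coord_sum_tmul, coord_sum_tmul] at this
    exact this
  · intro h
    refine eq_of_coord hσ fun q => ?_
    rw [coord_sum_tmul, coord_sum_tmul]
    by_cases hq : q ∈ r
    · exact congrFun h ⟨q, hq⟩
    · rw [Finset.sum_eq_zero fun p _ => by
          rw [apply_eq_zero_of_notMem_rowSupport σ (fun h => hq (hs h)) p, MulOpposite.op_zero,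
            zero_smul],
        Finset.sum_eq_zero fun p _ => by
          rw [apply_eq_zero_of_notMem_rowSupport σ (fun h => hq (ht h)) p, MulOpposite.op_zero,
            zero_smul]]

/-- The implication between finite systems expressing that cycles supported on `s` are boundaries
of chains supported on `t`. -/
def BoundsOn (d : P →ₗ[R] Q) (e : Q →ₗ[R] S) (s : Finset Q) (t : Finset P) (A : Type u)
    [AddCommGroup A] [Module Rᵐᵒᵖ A] : Prop :=
  ∀ x : s → A, ∑ q : s, tmul R (x q) (e q) = 0 →
    ∃ y : t → A, ∑ p : t, tmul R (y p) (d p) = ∑ q : s, tmul R (x q) (q : Q)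

/-- The matrices come from dual bases of `Q` and `S` and do not depend on `A`; this is what allows
the condition to be transported from one right module to another. -/
lemma exists_matrices_boundsOn_iff [Module.Projective R Q] [Module.Projective R S]
    (d : P →ₗ[R] Q) (e : Q →ₗ[R] S) (s : Finset Q) (t : Finset P) :
    ∃ (κ l : Type u) (_ : Fintype κ) (_ : Fintype l) (M : Matrix κ s R) (E : Matrix l s R)
      (B : Matrix l t R), ∀ (A : Type u) [AddCommGroup A] [Module Rᵐᵒᵖ A],
        BoundsOn d e s t A ↔ Matrix.RightImp M E B A := by
  classical
  obtain ⟨σ, hσ⟩ := Module.projective_def'.1 (inferInstance : Module.Projective R Q)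
  obtain ⟨τ, hτ⟩ := Module.projective_def'.1 (inferInstance : Module.Projective R S)
  let r : Finset Q := rowSupport σ s id ∪ rowSupport σ t d
  refine ⟨rowSupport τ s e, r, inferInstance, inferInstance, coordMatrix τ s e _,
    coordMatrix σ s id r, coordMatrix σ t d r, fun A _ _ => ?_⟩
  refine forall_congr' fun x => imp_congr ?_ (exists_congr fun y => ?_)
  -- The premise compares with zero, written here as a sum over the empty set.
  · have := sum_tmul_eq_iff hτ s e (∅ : Finset S) id (rowSupport τ s e) subset_rfl
      (by simp [rowSupport]) x (fun _ => (0 : A))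
    simp only [Finset.univ_eq_empty, Finset.sum_empty] at this
    rw [this]
    have h0 : (coordMatrix τ (∅ : Finset S) id (rowSupport τ s e)).rightAct A (fun _ => 0) = 0 :=
      map_zero _
    rw [h0]
  · exact sum_tmul_eq_iff hσ t d s id r Finset.subset_union_right Finset.subset_union_left y x

lemma map_id_sum (e : Q →ₗ[R] S) {s : Finset Q} {A : Type u} [AddCommGroup A] [Module Rᵐᵒᵖ A]
    (x : s → A) : BalancedTensor.map (LinearMap.id : A →ₗ[Rᵐᵒᵖ] A) e
      (∑ q : s, tmul R (x q) (q : Q)) = ∑ q : s, tmul R (x q) (e q) := by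
  rw [map_sum]; rfl

lemma tensorExactAt_of_boundsOn {d : P →ₗ[R] Q} {e : Q →ₗ[R] S} {A : Type u} [AddCommGroup A]
    [Module Rᵐᵒᵖ A] (h : ∀ s, ∃ t, BoundsOn d e s t A) : TensorExactAt d e A := by
  intro z hz
  obtain ⟨s, x, rfl⟩ := exists_eq_sum z
  obtain ⟨t, ht⟩ := h s
  rw [map_id_sum] at hz
  obtain ⟨y, hy⟩ := ht x hz
  exact ⟨∑ p : t, tmul R (y p) (p : P), by rw [map_id_sum, hy]⟩

/-- The functoriality of sums of tensors in the right module. -/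
lemma map_right_sum {A B : Type u} [AddCommGroup A] [Module Rᵐᵒᵖ A] [AddCommGroup B]
    [Module Rᵐᵒᵖ B] (g : A →ₗ[Rᵐᵒᵖ] B) {ι : Type*} [Fintype ι] (x : ι → A) (q : ι → Q) :
    BalancedTensor.map g (LinearMap.id : Q →ₗ[R] Q) (∑ i, tmul R (x i) (q i)) =
      ∑ i, tmul R (g (x i)) (q i) := by
  rw [map_sum]; rfl

/-- If tensoring with every injective module preserves exactness, then the bounding chains can be
chosen with support in a finite set that only depends on the support of the cycle. -/
lemma exists_boundsOn_of_injective [Module.Projective R Q] [Module.Projective R S]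
    {d : P →ₗ[R] Q} {e : Q →ₗ[R] S}
    (h : ∀ (I : Type u) [AddCommGroup I] [Module Rᵐᵒᵖ I], Module.Injective Rᵐᵒᵖ I →
      TensorExactAt d e I) (s : Finset Q) :
    ∃ t : Finset P, ∀ (I : Type u) [AddCommGroup I] [Module Rᵐᵒᵖ I],
      Module.Injective Rᵐᵒᵖ I → BoundsOn d e s t I := by
  classical
  -- Otherwise every finite `t` has an injective `I t` with a cycle that `t` fails to bound. In the
  -- product of all `I t` the combined cycle is bounded by a chain of some finite support `t`;
  -- projecting to that factor is a contradiction.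
  by_contra hne
  push Not at hne
  choose I hI1 hI2 hI hb using hne
  simp only [BoundsOn] at hb
  push Not at hb
  choose x hx hy using hb
  obtain ⟨τ, hτ⟩ := Module.projective_def'.1 (inferInstance : Module.Projective R S)
  have hinj : Module.Injective Rᵐᵒᵖ (∀ t, I t) := ⟨fun X Y _ _ _ _ f hf g => by
    choose k hk using fun t => (hI t).out f hf (LinearMap.proj t ∘ₗ g)
    exact ⟨LinearMap.pi k, fun x => funext fun t => hk t x⟩⟩
  have hz : ∑ q : s, tmul R (fun t => x t q : ∀ t, I t) (e q) = 0 := by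
    refine eq_zero_of_coord hτ fun k => ?_
    rw [coord_sum_tmul]
    funext t
    have := congrArg (coord (I t) τ k) (hx t)
    rw [coord_sum_tmul, map_zero] at this
    rw [Finset.sum_apply]
    exact this
  obtain ⟨y, hy'⟩ := h _ hinj (∑ q : s, tmul R (fun t => x t q : ∀ t, I t) (q : Q))
    (by rw [map_id_sum, hz])
  obtain ⟨t, y, rfl⟩ := exists_eq_sum y
  rw [map_id_sum] at hy'
  refine hy t (fun p => y p t) ?_
  have := congrArg (BalancedTensor.map (LinearMap.proj t : (∀ t, I t) →ₗ[Rᵐᵒᵖ] I t)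
    (LinearMap.id : Q →ₗ[R] Q)) hy'
  rw [map_right_sum, map_right_sum] at this
  exact this

end Compactness

/-! ### Null-homotopies from degreewise finite free complexes -/

section NullHomotopy

variable {R : Type u} [Ring R] {C : ℕ → Type u} [∀ k, AddCommGroup (C k)] [∀ k, Module R (C k)]

/-- The complex `C 0 → C 1 → ⋯` is exact in positive degrees, and remains so after applying
`Hom(D, -)` for all finitely presented modules `D`. -/
def IsPureExact (δ : ∀ k, C k →ₗ[R] C (k + 1)) : Prop :=
  ∀ (k : ℕ) (ι κ : Type u) [Finite ι] [Finite κ] (a : (κ →₀ R) →ₗ[R] (ι →₀ R))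
    (h : (ι →₀ R) →ₗ[R] C (k + 1)), h ∘ₗ a = 0 → δ (k + 1) ∘ₗ h = 0 →
    ∃ h' : (ι →₀ R) →ₗ[R] C k, h' ∘ₗ a = 0 ∧ δ k ∘ₗ h' = h

variable {δ : ∀ k, C k →ₗ[R] C (k + 1)}

/-- The correction `t` kills `d₀`, so replacing `s` by `s + t` leaves the relation one degree lower
intact. The last conclusion is the hypothesis on `s` one degree higher, so the step iterates. -/
lemma exists_homotopy_step (hδ : ∀ k, δ (k + 1) ∘ₗ δ k = 0) (hpure : IsPureExact δ)
    {ι₀ ι₁ ι₂ : Type u} [Finite ι₀] [Finite ι₁] [Finite ι₂]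
    {d₀ : (ι₀ →₀ R) →ₗ[R] (ι₁ →₀ R)} {d₁ : (ι₁ →₀ R) →ₗ[R] (ι₂ →₀ R)} (k : ℕ)
    {f₁ : (ι₁ →₀ R) →ₗ[R] C (k + 1)} {f₂ : (ι₂ →₀ R) →ₗ[R] C (k + 2)} (hd : d₁ ∘ₗ d₀ = 0)
    (hf : f₂ ∘ₗ d₁ = δ (k + 1) ∘ₗ f₁) (s : (ι₁ →₀ R) →ₗ[R] C k)
    (hs : (f₁ - δ k ∘ₗ s) ∘ₗ d₀ = 0) :
    ∃ (t : (ι₁ →₀ R) →ₗ[R] C k) (s' : (ι₂ →₀ R) →ₗ[R] C (k + 1)), t ∘ₗ d₀ = 0 ∧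
      f₁ = δ k ∘ₗ (s + t) + s' ∘ₗ d₁ ∧ (f₂ - δ (k + 1) ∘ₗ s') ∘ₗ d₁ = 0 := by
  have E := fun {M : Type u} [AddCommGroup M] [Module R M] (k : ℕ) (g : M →ₗ[R] C k) =>
    show δ (k + 1) ∘ₗ δ k ∘ₗ g = 0 by rw [← LinearMap.comp_assoc, hδ, LinearMap.zero_comp]
  -- Choosing `v` first makes `f₂ - v` a cycle, hence some `δ s'`. Then `f₂ - δ s' = v` kills `d₁`,
  -- which also makes the remaining error in `f₁` a cycle.
  obtain ⟨v, hv, hv'⟩ := hpure (k + 2) ι₂ ι₁ d₁ (δ (k + 2) ∘ₗ f₂)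
    (by rw [LinearMap.comp_assoc, hf, E]) (E _ _)
  obtain ⟨s', -, hs'⟩ := hpure (k + 1) ι₂ ι₂ 0 (f₂ - v) (by simp)
    (by rw [LinearMap.comp_sub, hv', sub_self])
  obtain ⟨t, ht, ht'⟩ := hpure k ι₁ ι₀ d₀ (f₁ - δ k ∘ₗ s - s' ∘ₗ d₁)
    (by rw [LinearMap.sub_comp, hs, LinearMap.comp_assoc, hd]; simp)
    (by
      rw [LinearMap.comp_sub, LinearMap.comp_sub, E, ← LinearMap.comp_assoc, hs',
        LinearMap.sub_comp, hv, hf]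
      simp)
  refine ⟨t, s', ht, ?_, ?_⟩
  · rw [LinearMap.comp_add, ht']; abel
  · rw [hs', sub_sub_cancel, hv]

/-- A map from a degreewise finite free complex to a pure exact complex is null-homotopic. -/
lemma exists_homotopy_of_finite (hδ : ∀ k, δ (k + 1) ∘ₗ δ k = 0) (hpure : IsPureExact δ)
    {B : ℕ → Type u} [∀ k, Finite (B k)]
    {d : ∀ k, (B k →₀ R) →ₗ[R] (B (k + 1) →₀ R)} (hd : ∀ k, d (k + 1) ∘ₗ d k = 0)
    {f : ∀ k, (B k →₀ R) →ₗ[R] C k} (hf : ∀ k, f (k + 1) ∘ₗ d k = δ k ∘ₗ f k) (hf₀ : f 0 = 0) :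
    ∃ s : ∀ k, (B (k + 1) →₀ R) →ₗ[R] C k, ∀ k, f (k + 1) = δ k ∘ₗ s k + s (k + 1) ∘ₗ d (k + 1) := by
  choose t s' ht hs hs' using fun (k : ℕ)
      (s : {s : (B (k + 1) →₀ R) →ₗ[R] C k // (f (k + 1) - δ k ∘ₗ s) ∘ₗ d k = 0}) =>
    exists_homotopy_step hδ hpure k (hd k) (hf (k + 1)) s.1 s.2
  let σ : ∀ k, {s : (B (k + 1) →₀ R) →ₗ[R] C k // (f (k + 1) - δ k ∘ₗ s) ∘ₗ d k = 0} := fun k =>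
    Nat.rec ⟨0, by rw [LinearMap.comp_zero, sub_zero, hf, hf₀, LinearMap.comp_zero]⟩
      (fun k s => ⟨s' k s, hs' k s⟩) k
  refine ⟨fun k => (σ k).1 + t k (σ k), fun k => ?_⟩
  rw [LinearMap.add_comp, ht, add_zero]
  exact hs k (σ k)

end NullHomotopy

/-! ### Null-homotopies from arbitrary free complexes -/

section Free

variable {R : Type u} [Ring R] {C : ℕ → Type u} [∀ k, AddCommGroup (C k)] [∀ k, Module R (C k)]
  {B : ℕ → Type u} (d : ∀ k, (B k →₀ R) →ₗ[R] (B (k + 1) →₀ R))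

/-- A family of sets of basis elements spans a subcomplex. -/
def IsClosedUnder (S : ∀ k, Set (B k)) : Prop :=
  ∀ k, ∀ b ∈ S k, ∀ c, d k (Finsupp.single b 1) c ≠ 0 → c ∈ S (k + 1)

/-- The basis elements occurring in iterated differentials of `b`, together with `b`. -/
noncomputable def descendants {k₀ : ℕ} (b : B k₀) : ∀ k, Set (B k)
  | 0 => {c | (⟨0, c⟩ : Σ k, B k) = ⟨k₀, b⟩}
  | k + 1 => {c | (⟨k + 1, c⟩ : Σ k, B k) = ⟨k₀, b⟩} ∪
      ⋃ a : descendants b k, {c | d k (Finsupp.single a.1 1) c ≠ 0}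

lemma mem_descendants {k₀ : ℕ} (b : B k₀) : b ∈ descendants d b k₀ := by
  cases k₀ with
  | zero => rfl
  | succ k => exact Or.inl rfl

lemma isClosedUnder_descendants {k₀ : ℕ} (b : B k₀) : IsClosedUnder d (descendants d b) :=
  fun _ a ha _ hc => Or.inr (Set.mem_iUnion.2 ⟨⟨a, ha⟩, hc⟩)

lemma finite_descendants {k₀ : ℕ} (b : B k₀) (k : ℕ) : (descendants d b k).Finite := by
  have h : ∀ k, {c | (⟨k, c⟩ : Σ k, B k) = ⟨k₀, b⟩}.Finite := fun k =>
    Set.Subsingleton.finite fun x hx y hy =>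
      eq_of_heq (Sigma.mk.inj (Eq.trans (show (⟨k, x⟩ : Σ k, B k) = ⟨k₀, b⟩ from hx)
        (Eq.symm hy))).2
  induction k with
  | zero => exact h 0
  | succ k ih =>
    have := ih.to_subtype
    exact (h (k + 1)).union (Set.finite_iUnion fun a => (d k (Finsupp.single a.1 1)).hasFiniteSupport)

variable {d} {δ : ∀ k, C k →ₗ[R] C (k + 1)}

/-- The homotopy relation `f = δ s + s d` on the basis elements in `S`. -/
def IsHomotopyOn (d : ∀ k, (B k →₀ R) →ₗ[R] (B (k + 1) →₀ R)) (δ : ∀ k, C k →ₗ[R] C (k + 1))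
    (f : ∀ k, (B k →₀ R) →ₗ[R] C k) (S : ∀ k, Set (B k))
    (s : ∀ k, (B (k + 1) →₀ R) →ₗ[R] C k) : Prop :=
  ∀ k, ∀ b ∈ S (k + 1), f (k + 1) (Finsupp.single b 1) =
    δ k (s k (Finsupp.single b 1)) + s (k + 1) (d (k + 1) (Finsupp.single b 1))

lemma linearMap_congr_of_support {α : Type*} {M : Type*} [AddCommGroup M] [Module R M]
    {s t : (α →₀ R) →ₗ[R] M} (x : α →₀ R)
    (h : ∀ a, x a ≠ 0 → s (Finsupp.single a 1) = t (Finsupp.single a 1)) : s x = t x := by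
  rw [← x.sum_single]
  simp only [Finsupp.sum, map_sum]
  refine Finset.sum_congr rfl fun a ha => ?_
  rw [← mul_one (x a), ← smul_eq_mul, ← Finsupp.smul_single, map_smul, map_smul,
    h a (Finsupp.mem_support_iff.1 ha)]

/-- A homotopy on a subcomplex extends to a subcomplex containing a further basis element. -/
lemma IsHomotopyOn.exists_extension (hδ : ∀ k, δ (k + 1) ∘ₗ δ k = 0) (hpure : IsPureExact δ)
    (hd : ∀ k, d (k + 1) ∘ₗ d k = 0) {f : ∀ k, (B k →₀ R) →ₗ[R] C k}
    (hf : ∀ k, f (k + 1) ∘ₗ d k = δ k ∘ₗ f k) (hf₀ : f 0 = 0) {S T : ∀ k, Set (B k)}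
    {s : ∀ k, (B (k + 1) →₀ R) →ₗ[R] C k} (hS : IsClosedUnder d S)
    (hs : IsHomotopyOn d δ f S s) (hT : IsClosedUnder d T) (hfin : ∀ k, (T k).Finite)
    [Subsingleton (C 0)] :
    ∃ s' : ∀ k, (B (k + 1) →₀ R) →ₗ[R] C k,
      (∀ k, ∀ b ∈ S (k + 1), s' k (Finsupp.single b 1) = s k (Finsupp.single b 1)) ∧
      IsHomotopyOn d δ f (fun k => S k ∪ T k) s' := by
  -- The quotient of the span of `S ∪ T` by the span of `S` is free on `N`, finite in each degree.
  let N : ∀ k, Set (B k) := fun k => T k \ S k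
  have : ∀ k, Finite (N k) := fun k => ((hfin k).subset Set.sdiff_subset).to_subtype
  let i : ∀ k, (N k →₀ R) →ₗ[R] (B k →₀ R) := fun k => Finsupp.lmapDomain R R Subtype.val
  let p : ∀ k, (B k →₀ R) →ₗ[R] (N k →₀ R) := fun k => Finsupp.lsubtypeDomain (N k)
  -- The failure of `s` to be a homotopy. It is a chain map vanishing on `S`, so it descends to the
  -- quotient, where the finite case applies.
  let φ : ∀ k, (B k →₀ R) →ₗ[R] C k := fun k => match k with
    | 0 => 0
    | k + 1 => f (k + 1) - δ k ∘ₗ s k - s (k + 1) ∘ₗ d (k + 1)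
  have hφ : ∀ k, φ (k + 1) ∘ₗ d k = δ k ∘ₗ φ k := by
    intro k
    ext b
    have h1 := fun (k : ℕ) x => LinearMap.congr_fun (hf k) x
    have h2 := fun (k : ℕ) x => LinearMap.congr_fun (hd k) x
    have h3 := fun (k : ℕ) x => LinearMap.congr_fun (hδ k) x
    simp only [LinearMap.comp_apply, LinearMap.zero_apply] at h1 h2 h3
    match k with
    | 0 =>
      have h0 : s 0 (d 0 (Finsupp.single b 1)) = 0 := Subsingleton.elim _ _
      simp [φ, h1, h2, h0, hf₀]
    | k + 1 => simp [φ, h1, h2, h3]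
  have hφS : ∀ k, ∀ b ∈ S k, φ k (Finsupp.single b 1) = 0 := by
    intro k b hb
    match k with
    | 0 => rfl
    | k + 1 => simp [φ, hs k b hb]
  have hi : ∀ k (b : N k), i k (Finsupp.single b 1) = Finsupp.single b.1 1 := fun k b => by
    simp [i]
  have hpN : ∀ k (b : N k), p k (Finsupp.single b.1 1) = Finsupp.single b 1 := fun k b => by
    ext c
    change Finsupp.single b.1 (1 : R) c.1 = _
    rcases eq_or_ne b c with rfl | h
    · simp
    · rw [Finsupp.single_eq_of_ne h.symm, Finsupp.single_eq_of_ne fun e => h (Subtype.ext e.symm)]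
  have hpS : ∀ k, ∀ b ∈ S k, p k (Finsupp.single b 1) = 0 := fun k b hb => by
    ext c
    have : b ≠ c.1 := fun h => c.2.2 (h ▸ hb)
    simp [p, Finsupp.lsubtypeDomain, this]
  -- On `S ∪ T` the composite `i ∘ p` only discards components in `S`, which is invisible to maps
  -- vanishing there.
  have hpd : ∀ k, ∀ b ∈ S k ∪ T k, ∀ {M : Type u} [AddCommGroup M] [Module R M]
      (g : (B (k + 1) →₀ R) →ₗ[R] M), (∀ c ∈ S (k + 1), g (Finsupp.single c 1) = 0) →
      g (i (k + 1) (p (k + 1) (d k (Finsupp.single b 1)))) = g (d k (Finsupp.single b 1)) := by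
    intro k b hb M _ _ g hg
    refine linearMap_congr_of_support (s := g ∘ₗ i (k + 1) ∘ₗ p (k + 1)) (t := g) _ fun c hc => ?_
    by_cases hcS : c ∈ S (k + 1)
    · simp [hpS _ c hcS, hg c hcS]
    · have hcT : c ∈ T (k + 1) := hb.elim (fun h => absurd (hS k b h c hc) hcS)
        fun h => hT k b h c hc
      have := hpN (k + 1) ⟨c, hcT, hcS⟩
      simp only [LinearMap.comp_apply]
      rw [this, hi]
  obtain ⟨τ, hτ⟩ := exists_homotopy_of_finite hδ hpure (B := fun k => N k)
    (d := fun k => p (k + 1) ∘ₗ d k ∘ₗ i k) (f := fun k => φ k ∘ₗ i k)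
    (fun k => by
      ext b : 2
      have h1 := hpd k b.1 (Or.inr b.2.1) (p (k + 2) ∘ₗ d (k + 1)) fun c hc => by
        have := linearMap_congr_of_support (s := p (k + 2)) (t := 0)
          (d (k + 1) (Finsupp.single c 1)) fun a ha => hpS _ a (hS _ c hc a ha)
        simpa using this
      have h2 := LinearMap.congr_fun (hd k) (Finsupp.single b.1 1)
      simp only [LinearMap.comp_apply, Finsupp.lsingle_apply, hi, LinearMap.zero_apply] at h1 h2 ⊢
      rw [h1, h2, map_zero])
    (fun k => by
      ext b : 2
      have h1 := hpd k b.1 (Or.inr b.2.1) (φ (k + 1)) (hφS _)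
      have h2 := LinearMap.congr_fun (hφ k) (Finsupp.single b.1 1)
      simp only [LinearMap.comp_apply, Finsupp.lsingle_apply, hi] at h1 h2 ⊢
      rw [h1, h2])
    (by simp [φ])
  refine ⟨fun k => s k + τ k ∘ₗ p (k + 1), fun k b hb => by simp [hpS _ b hb], fun k b hb => ?_⟩
  by_cases hbS : b ∈ S (k + 1)
  · have h1 := linearMap_congr_of_support (s := p (k + 2)) (t := 0)
      (d (k + 1) (Finsupp.single b 1)) fun a ha => hpS _ a (hS _ b hbS a ha)
    simp [hs k b hbS, hpS _ b hbS, h1]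
  · have hbT : b ∈ T (k + 1) := hb.resolve_left hbS
    have h1 := LinearMap.congr_fun (hτ k) (Finsupp.single ⟨b, hbT, hbS⟩ 1)
    have h2 := hpN (k + 1) ⟨b, hbT, hbS⟩
    simp only [LinearMap.comp_apply, LinearMap.add_apply, hi, φ, LinearMap.sub_apply] at h1 h2 ⊢
    rw [h2, map_add, eq_add_of_sub_eq (eq_add_of_sub_eq h1)]
    abel

/-- A map from a complex of free modules to a pure exact complex is null-homotopic. -/
lemma exists_homotopy_of_free (hδ : ∀ k, δ (k + 1) ∘ₗ δ k = 0) (hpure : IsPureExact δ)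
    [Subsingleton (C 0)] (hd : ∀ k, d (k + 1) ∘ₗ d k = 0) {f : ∀ k, (B k →₀ R) →ₗ[R] C k}
    (hf : ∀ k, f (k + 1) ∘ₗ d k = δ k ∘ₗ f k) :
    ∃ s : ∀ k, (B (k + 1) →₀ R) →ₗ[R] C k,
      ∀ k, f (k + 1) = δ k ∘ₗ s k + s (k + 1) ∘ₗ d (k + 1) := by
  classical
  have hf₀ : f 0 = 0 := LinearMap.ext fun _ => Subsingleton.elim _ _
  let X := {q : (∀ k, Set (B k)) × (∀ k, (B (k + 1) →₀ R) →ₗ[R] C k) //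
    IsClosedUnder d q.1 ∧ IsHomotopyOn d δ f q.1 q.2}
  -- Only a preorder: values of the homotopy off the chosen set are irrelevant.
  let r : X → X → Prop := fun x y => (∀ k, x.1.1 k ⊆ y.1.1 k) ∧
    ∀ k, ∀ b ∈ x.1.1 (k + 1), y.1.2 k (Finsupp.single b 1) = x.1.2 k (Finsupp.single b 1)
  have hrefl : ∀ x, r x x := fun x => ⟨fun _ => subset_rfl, fun _ _ _ => rfl⟩
  have htrans : ∀ {x y z}, r x y → r y z → r x z := fun hxy hyz =>
    ⟨fun k => (hxy.1 k).trans (hyz.1 k), fun k b hb =>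
      (hyz.2 k b (hxy.1 _ hb)).trans (hxy.2 k b hb)⟩
  obtain ⟨m, hm⟩ := exists_maximal_of_chains_bounded (r := r) (fun c hc => by
    let S : ∀ k, Set (B k) := fun k => ⋃ x ∈ c, x.1.1 k
    let v : ∀ k, B (k + 1) → C k := fun k b =>
      if h : ∃ x ∈ c, b ∈ x.1.1 (k + 1) then h.choose.1.2 k (Finsupp.single b 1) else 0
    let s : ∀ k, (B (k + 1) →₀ R) →ₗ[R] C k := fun k => Finsupp.linearCombination R (v k)
    have hsv : ∀ x ∈ c, ∀ k, ∀ b ∈ x.1.1 (k + 1),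
        s k (Finsupp.single b 1) = x.1.2 k (Finsupp.single b 1) := by
      intro x hx k b hb
      have h : ∃ x ∈ c, b ∈ x.1.1 (k + 1) := ⟨x, hx, hb⟩
      have h1 : s k (Finsupp.single b 1) = h.choose.1.2 k (Finsupp.single b 1) := by
        simp [s, v, dif_pos h]
      rw [h1]
      rcases eq_or_ne h.choose x with he | he
      · rw [he]
      · rcases hc h.choose_spec.1 hx he with hr | hr
        · exact (hr.2 k b h.choose_spec.2).symm
        · exact hr.2 k b hb
    refine ⟨⟨(S, s), fun k b hb a ha => ?_, fun k b hb => ?_⟩, fun x hx =>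
      ⟨fun k => Set.subset_biUnion_of_mem (u := fun x : X => x.1.1 k) hx, hsv x hx⟩⟩
    · obtain ⟨x, hx, hbx⟩ := Set.mem_iUnion₂.1 hb
      exact Set.mem_biUnion hx (x.2.1 k b hbx a ha)
    · obtain ⟨x, hx, hbx⟩ := Set.mem_iUnion₂.1 hb
      rw [x.2.2 k b hbx, hsv x hx k b hbx]
      congr 1
      exact (linearMap_congr_of_support _ fun a ha =>
        hsv x hx (k + 1) a (x.2.1 _ b hbx a ha)).symm) htrans
  have hall : ∀ k (b : B k), b ∈ m.1.1 k := by
    intro k b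
    obtain ⟨s', h1, h2⟩ := m.2.2.exists_extension hδ hpure hd hf hf₀ m.2.1
      (isClosedUnder_descendants d b) (finite_descendants d b)
    have hcl : IsClosedUnder d fun k => m.1.1 k ∪ descendants d b k := fun k a ha c hc =>
      ha.imp (fun h => m.2.1 k a h c hc) fun h => isClosedUnder_descendants d b k a h c hc
    have := (hm ⟨(_, s'), hcl, h2⟩ ⟨fun _ => Set.subset_union_left, h1⟩).1 k
    exact this (Or.inr (mem_descendants d b))
  refine ⟨m.1.2, fun k => ?_⟩
  ext b
  exact m.2.2 k b (hall _ b)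

end Free

/-! ### Passage from free to projective complexes -/

section Projective

variable {R : Type u} [Ring R] {C : ℕ → Type u} [∀ k, AddCommGroup (C k)] [∀ k, Module R (C k)]
  {P : ℕ → Type u} [∀ k, AddCommGroup (P k)] [∀ k, Module R (P k)]

/-- A map from a complex of projective modules to a pure exact complex is null-homotopic. -/
lemma exists_homotopy_of_projective {δ : ∀ k, C k →ₗ[R] C (k + 1)}
    (hδ : ∀ k, δ (k + 1) ∘ₗ δ k = 0) (hpure : IsPureExact δ) [Subsingleton (C 0)]
    (hP : ∀ k, Module.Projective R (P k)) {d : ∀ k, P k →ₗ[R] P (k + 1)}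
    (hd : ∀ k, d (k + 1) ∘ₗ d k = 0) {f : ∀ k, P k →ₗ[R] C k}
    (hf : ∀ k, f (k + 1) ∘ₗ d k = δ k ∘ₗ f k) :
    ∃ s : ∀ k, P (k + 1) →ₗ[R] C k,
      ∀ k, f (k + 1) = δ k ∘ₗ s k + s (k + 1) ∘ₗ d (k + 1) := by
  choose σ hσ using fun k => Module.projective_def'.1 (hP k)
  let π : ∀ k, (P k →₀ R) →ₗ[R] P k := fun k => Finsupp.linearCombination R id
  have hσ' : ∀ k x, π k (σ k x) = x := fun k x => LinearMap.congr_fun (hσ k) x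
  have hd' : ∀ k x, d (k + 1) (d k x) = 0 := fun k x => LinearMap.congr_fun (hd k) x
  have hf' : ∀ k x, f (k + 1) (d k x) = δ k (f k x) := fun k x => LinearMap.congr_fun (hf k) x
  -- With differentials `σ d π` the free modules form a complex having `P` as a retract, since `σ`
  -- and `π` are chain maps with `π σ = 1`.
  obtain ⟨s, hs⟩ := exists_homotopy_of_free hδ hpure (B := P)
    (d := fun k => σ (k + 1) ∘ₗ d k ∘ₗ π k) (f := fun k => f k ∘ₗ π k)
    (fun k => LinearMap.ext fun x => by simp [hσ', hd'])
    (fun k => LinearMap.ext fun x => by simp [hσ', hf'])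
  refine ⟨fun k => s k ∘ₗ σ (k + 1), fun k => LinearMap.ext fun x => ?_⟩
  have := LinearMap.congr_fun (hs k) (σ (k + 1) x)
  simpa [hσ'] using this

end Projective

/-! ### The pure coresolution by double character modules -/

section Coresolution

variable {R : Type u} [Ring R]

lemma exists_comp_eq_of_forall_mem_range {M X Y : Type u} [AddCommGroup M] [Module R M]
    [AddCommGroup X] [Module R X] [AddCommGroup Y] [Module R Y] {j : X →ₗ[R] Y}
    (hj : Function.Injective j) (h : M →ₗ[R] Y) (hh : ∀ x, h x ∈ LinearMap.range j) :
    ∃ h' : M →ₗ[R] X, j ∘ₗ h' = h := by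
  refine ⟨(LinearEquiv.ofInjective j hj).symm.toLinearMap ∘ₗ h.codRestrict _ hh, ?_⟩
  ext x
  exact congrArg Subtype.val ((LinearEquiv.ofInjective j hj).apply_symm_apply ⟨h x, hh x⟩)

namespace CharacterModule

/-- The iterated cokernels of evaluation maps into double character modules. -/
noncomputable def cosyzygy (F : ModuleCat.{u} R) : ℕ → ModuleCat.{u} R
  | 0 => F
  | k + 1 => ModuleCat.of R (Coeval R (cosyzygy F k))

/-- The terms of the pure coresolution of `F` by double character modules, with `F` itself placed
in degree one. -/
noncomputable def coresolution (F : ModuleCat.{u} R) : ℕ → ModuleCat.{u} R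
  | 0 => ModuleCat.of R PUnit
  | 1 => F
  | k + 2 => ModuleCat.of R (CharacterModule (CharacterModule (cosyzygy F k)))

/-- The differentials of the pure coresolution by double character modules. -/
noncomputable def coresolutionD (F : ModuleCat.{u} R) :
    ∀ k, coresolution F k →ₗ[R] coresolution F (k + 1)
  | 0 => 0
  | 1 => eval R F
  | k + 2 => eval R (Coeval R (cosyzygy F k)) ∘ₗ (LinearMap.range (eval R (cosyzygy F k))).mkQ

lemma coresolutionD_comp (F : ModuleCat.{u} R) :
    ∀ k, coresolutionD F (k + 1) ∘ₗ coresolutionD F k = 0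
  | 0 => LinearMap.comp_zero _
  | 1 => by
    refine LinearMap.ext fun x => ?_
    have : (LinearMap.range (eval R F)).mkQ (eval R F x) = 0 :=
      (Submodule.Quotient.mk_eq_zero _).2 ⟨x, rfl⟩
    exact (congrArg (eval R (Coeval R F)) this).trans (map_zero _)
  | k + 2 => by
    refine LinearMap.ext fun x => ?_
    let y := (LinearMap.range (eval R (cosyzygy F k))).mkQ x
    have : (LinearMap.range (eval R (Coeval R (cosyzygy F k)))).mkQ (eval R _ y) = 0 :=
      (Submodule.Quotient.mk_eq_zero _).2 ⟨y, rfl⟩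
    exact (congrArg (eval R (Coeval R (Coeval R (cosyzygy F k)))) this).trans (map_zero _)

/-- Maps into a double character module that vanish in the cokernel of evaluation factor through
evaluation. -/
lemma exists_eval_comp_eq {M K N : Type u} [AddCommGroup M] [Module R M] [AddCommGroup K]
    [Module R K] [AddCommGroup N] [Module R N] (a : K →ₗ[R] M)
    (h : M →ₗ[R] CharacterModule (CharacterModule N)) (ha : h ∘ₗ a = 0)
    (hh : (eval R (Coeval R N) ∘ₗ (LinearMap.range (eval R N)).mkQ) ∘ₗ h = 0) :
    ∃ h' : M →ₗ[R] N, h' ∘ₗ a = 0 ∧ eval R N ∘ₗ h' = h := by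
  obtain ⟨h', rfl⟩ := exists_comp_eq_of_forall_mem_range (eval_injective N) h fun x => by
    have := eval_injective _ ((LinearMap.congr_fun hh x).trans
      (map_zero (eval R (Coeval R N))).symm)
    exact (Submodule.Quotient.mk_eq_zero _).1 this
  refine ⟨h', LinearMap.ext fun x => eval_injective (R := R) N ?_, rfl⟩
  exact (LinearMap.congr_fun ha x).trans (map_zero (eval R N)).symm

/-- Maps from finitely presented modules lift from the cokernel of evaluation. -/
lemma exists_mkQ_comp_eq {ι κ : Type u} [Finite ι] [Finite κ] {N : Type u} [AddCommGroup N]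
    [Module R N] (a : (κ →₀ R) →ₗ[R] (ι →₀ R)) (h : (ι →₀ R) →ₗ[R] Coeval R N) (ha : h ∘ₗ a = 0) :
    ∃ h' : (ι →₀ R) →ₗ[R] CharacterModule (CharacterModule N),
      h' ∘ₗ a = 0 ∧ (LinearMap.range (eval R N)).mkQ ∘ₗ h' = h := by
  classical
  have := Fintype.ofFinite ι
  have := Fintype.ofFinite κ
  have key : ∀ {M : Type u} [AddCommGroup M] [Module R M] (g : (ι →₀ R) →ₗ[R] M) (k : κ),
      g (a (Finsupp.single k 1)) =
        ∑ i, a (Finsupp.single k 1) i • g (Finsupp.single i 1) := fun g k => by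
    conv_lhs => rw [← Finsupp.univ_sum_single (a (Finsupp.single k 1)), map_sum]
    refine Finset.sum_congr rfl fun i _ => ?_
    rw [← map_smul, Finsupp.smul_single, smul_eq_mul, mul_one]
  obtain ⟨v, hv, hvw⟩ := exists_lift_of_leftAct_eq_zero
    (Matrix.of fun (i : ι) (k : κ) => a (Finsupp.single k 1) i)
    (fun i => h (Finsupp.single i 1))
    (funext fun k => (key h k).symm.trans (LinearMap.congr_fun ha _))
  refine ⟨Finsupp.linearCombination R v, ?_, ?_⟩
  · ext k : 2
    have := key (Finsupp.linearCombination R v) k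
    simp only [Finsupp.linearCombination_single, one_smul] at this
    exact this.trans (congrFun hv k)
  · ext i : 2
    simpa using hvw i

/-- A cycle factors through the previous cosyzygy because evaluation is injective. Finite
presentation is needed only to lift it from there to the preceding double dual. -/
lemma isPureExact_coresolution (F : ModuleCat.{u} R) : IsPureExact (coresolutionD F)
  | 0, ι, κ, _, _, a, h, ha, hh => by
    refine ⟨0, rfl, ?_⟩
    refine LinearMap.ext fun x => (eval_injective (R := R) F ?_)
    exact (map_zero (eval R F)).trans (LinearMap.congr_fun hh x).symm
  | 1, ι, κ, _, _, a, h, ha, hh => exists_eval_comp_eq a h ha hh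
  | k + 2, ι, κ, _, _, a, h, ha, hh => by
    obtain ⟨g, hg, hgh⟩ := exists_eval_comp_eq a h ha hh
    obtain ⟨f, hf, hfg⟩ := exists_mkQ_comp_eq a g hg
    refine ⟨f, hf, ?_⟩
    rw [← hgh, ← hfg]
    rfl

end CharacterModule

variable {P Q S : Type u} [AddCommGroup P] [Module R P] [AddCommGroup Q] [Module R Q]
  [AddCommGroup S] [Module R S] [Module.Projective R Q] [Module.Projective R S]

/-- Exactness after tensoring with all injective modules gives exactness of the maps into all terms
of the pure coresolution of a flat module. -/
lemma homExactAt_coresolution {d : P →ₗ[R] Q} {e : Q →ₗ[R] S}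
    (h : ∀ (I : Type u) [AddCommGroup I] [Module Rᵐᵒᵖ I], Module.Injective Rᵐᵒᵖ I →
      TensorExactAt d e I) {F : ModuleCat.{u} R} (hF : IsFlatLeft R F) (k : ℕ) :
    HomExactAt d e (CharacterModule.coresolution F (k + 2)) := by
  refine (tensorExactAt_iff_homExactAt d e
    (CharacterModule (CharacterModule.cosyzygy F k))).1 (tensorExactAt_of_boundsOn fun s => ?_)
  obtain ⟨t, ht⟩ := exists_boundsOn_of_injective h s
  obtain ⟨κ, l, _, _, A, E, B, hAEB⟩ := exists_matrices_boundsOn_iff d e s t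
  -- The support `t` found for injectives serves every cosyzygy: `F⁺` is injective, and the
  -- implication passes to successive cokernels.
  refine ⟨t, (hAEB _).2 (Matrix.leftImp_iff_rightImp_char.1 ?_)⟩
  induction k with
  | zero =>
    exact Matrix.leftImp_iff_rightImp_char.2
      ((hAEB _).1 (ht _ (injective_char_of_isFlatLeft hF)))
  | succ k ih => exact CharacterModule.leftImp_coeval ih

end Coresolution

/-! ### From tensor exactness to Hom exactness for flat modules -/

section NatIndexed

variable {R : Type u} [Ring R] {P : ℕ → Type u} [∀ k, AddCommGroup (P k)] [∀ k, Module R (P k)]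

/-- A complex of projective modules that stays exact after tensoring with injective modules stays
exact after applying `Hom(-, F)` for every flat module `F`. -/
lemma homExactAt_of_isFlatLeft (hP : ∀ k, Module.Projective R (P k))
    {d : ∀ k, P k →ₗ[R] P (k + 1)} (hd : ∀ k, d (k + 1) ∘ₗ d k = 0)
    (h : ∀ (I : Type u) [AddCommGroup I] [Module Rᵐᵒᵖ I], Module.Injective Rᵐᵒᵖ I →
      ∀ k, TensorExactAt (d k) (d (k + 1)) I)
    {F : Type u} [AddCommGroup F] [Module R F] (hF : IsFlatLeft R F) :
    HomExactAt (d 0) (d 1) F := by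
  intro g hg
  let C := CharacterModule.coresolution (ModuleCat.of R F)
  let δ : ∀ k, C k →ₗ[R] C (k + 1) := CharacterModule.coresolutionD (ModuleCat.of R F)
  have hδ : ∀ k, δ (k + 1) ∘ₗ δ k = 0 := CharacterModule.coresolutionD_comp _
  have : Subsingleton (C 0) := inferInstanceAs (Subsingleton PUnit)
  have hC : ∀ k, HomExactAt (d k) (d (k + 1)) (C (k + 2)) := fun k =>
    have := hP (k + 1)
    have := hP (k + 2)
    homExactAt_coresolution (F := ModuleCat.of R F) (fun I _ _ hI => h I hI k) hF k
  choose n hn using fun (k : ℕ)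
    (φ : {φ : P (k + 1) →ₗ[R] C (k + 1) // (δ (k + 1) ∘ₗ φ) ∘ₗ d k = 0}) => hC k _ φ.2
  -- Extension of `g` to a chain map: `δ φ` kills the incoming differential, so exactness of Hom
  -- into the next term of the coresolution gives the next component.
  let φ : ∀ k, {φ : P (k + 1) →ₗ[R] C (k + 1) // (δ (k + 1) ∘ₗ φ) ∘ₗ d k = 0} := fun k =>
    Nat.rec ⟨g, LinearMap.ext fun x => (congrArg (δ 1) (LinearMap.congr_fun hg x)).trans (map_zero _)⟩
      (fun k φ => ⟨n k φ, by
        rw [LinearMap.comp_assoc, hn, ← LinearMap.comp_assoc, hδ, LinearMap.zero_comp]⟩) k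
  let f : ∀ k, P k →ₗ[R] C k := fun k => match k with
    | 0 => 0
    | k + 1 => (φ k).1
  obtain ⟨s, hs⟩ := exists_homotopy_of_projective hδ
    (CharacterModule.isPureExact_coresolution _) hP hd (f := f) fun k => by
      match k with
      | 0 => exact hg.trans (LinearMap.comp_zero _).symm
      | k + 1 => exact hn k (φ k)
  -- Since `C 0` is zero, the homotopy relation at `g` reduces to `g = s 1 ∘ d 1`.
  refine ⟨s 1, ?_⟩
  have h0 : s 0 = 0 := LinearMap.ext fun x => Subsingleton.elim _ _
  have h1 := hs 0
  rw [h0, LinearMap.comp_zero] at h1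
  exact (h1.trans (zero_add _)).symm

end NatIndexed

/-! ### Unbounded complexes and finite flat dimension -/

section Complexes

variable {R : Type u} [Ring R] {P : ChainComplex (ModuleCat.{u} R) ℤ}

lemma d_hom_comp_d_hom (P : ChainComplex (ModuleCat.{u} R) ℤ) (i j k : ℤ) :
    (P.d j k).hom ∘ₗ (P.d i j).hom = 0 := by
  rw [← ModuleCat.hom_comp, P.d_comp_d, ModuleCat.hom_zero]

lemma isHomExact_iff {N : Type u} [AddCommGroup N] [Module R N] :
    IsHomExact P N ↔
      ∀ i j k, j + 1 = i → k + 1 = j → HomExactAt (P.d i j).hom (P.d j k).hom N := by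
  constructor
  · rintro h i j k rfl hk g hg
    obtain rfl : k = j - 1 := by lia
    exact (h j g).1 hg
  · intro h i g
    refine ⟨fun hg => h (i + 1) i (i - 1) rfl (by lia) g hg, ?_⟩
    rintro ⟨g', rfl⟩
    change (g' ∘ₗ _) ∘ₗ _ = 0
    rw [LinearMap.comp_assoc, d_hom_comp_d_hom, LinearMap.comp_zero]

lemma isTensorExact_iff {A : Type u} [AddCommGroup A] [Module Rᵐᵒᵖ A] :
    IsTensorExact P A ↔
      ∀ i j k, j + 1 = i → k + 1 = j → TensorExactAt (P.d i j).hom (P.d j k).hom A := by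
  constructor
  · rintro h i j k rfl hk z hz
    obtain rfl : k = j - 1 := by lia
    exact (h j z).1 hz
  · intro h i z
    refine ⟨fun hz => h (i + 1) i (i - 1) rfl (by lia) z hz, ?_⟩
    rintro ⟨y, rfl⟩
    suffices hc : (BalancedTensor.map (LinearMap.id : A →ₗ[Rᵐᵒᵖ] A) (P.d i (i - 1)).hom).comp
        (BalancedTensor.map LinearMap.id (P.d (i + 1) i).hom) = 0 from DFunLike.congr_fun hc y
    refine addHom_ext fun a m => ?_
    change tmul R a ((P.d i (i - 1)).hom ((P.d (i + 1) i).hom m)) = 0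
    rw [← LinearMap.comp_apply, d_hom_comp_d_hom, LinearMap.zero_apply, tmul_zero]

lemma isTensorExact_iff_isHomExact {A : Type u} [AddCommGroup A] [Module Rᵐᵒᵖ A] :
    IsTensorExact P A ↔ IsHomExact P (CharacterModule A) := by
  simp only [isTensorExact_iff, isHomExact_iff, tensorExactAt_iff_homExactAt]

lemma IsExactProjectiveComplex.isHomExact_of_isFlatLeft (hP : IsExactProjectiveComplex P)
    (h : ∀ (I : Type u) [AddCommGroup I] [Module Rᵐᵒᵖ I],
      Module.Injective Rᵐᵒᵖ I → IsTensorExact P I)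
    {F : Type u} [AddCommGroup F] [Module R F] (hF : IsFlatLeft R F) : IsHomExact P F := by
  refine isHomExact_iff.2 fun i j k hj hk => ?_
  -- Only the part of `P` from degree `i` downwards matters; it is reindexed by `n ↦ i - n`.
  obtain ⟨i, rfl⟩ : ∃ i' : ℤ, i = i' - (0 : ℕ) := ⟨i, by simp⟩
  obtain rfl : j = i - (0 + 1 : ℕ) := by push_cast at hj ⊢; lia
  obtain rfl : k = i - (1 + 1 : ℕ) := by push_cast at hk ⊢; lia
  have := homExactAt_of_isFlatLeft (P := fun n : ℕ => P.X (i - n)) (fun n => hP.projective _)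
    (d := fun n => (P.d (i - n) (i - (n + 1 : ℕ))).hom) (fun n => d_hom_comp_d_hom P _ _ _)
    (fun I _ _ hI n => isTensorExact_iff.1 (h I hI) _ _ _ (by push_cast; ring)
      (by push_cast; ring)) hF
  exact this

/-- Exact complexes stay exact after applying `Hom(-, E)` for an injective module `E`. -/
lemma IsExactProjectiveComplex.isHomExact_of_injective (hP : IsExactProjectiveComplex P)
    {E : Type u} [AddCommGroup E] [Module R E] (hE : Module.Injective R E) : IsHomExact P E := by
  intro i g
  refine ⟨fun hg => ?_, ?_⟩
  · let q := (LinearMap.ker (P.d i (i - 1)).hom).liftQ (P.d i (i - 1)).hom le_rfl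
    have hq : Function.Injective q :=
      LinearMap.ker_eq_bot.1 (Submodule.ker_liftQ_eq_bot _ _ _ le_rfl)
    obtain ⟨h, hh⟩ := hE.out q hq
      ((LinearMap.ker (P.d i (i - 1)).hom).liftQ g fun x hx => by
        obtain ⟨y, rfl⟩ := (hP.exact i x).1 hx
        exact LinearMap.congr_fun hg y)
    exact ⟨h, LinearMap.ext fun x => hh (Submodule.Quotient.mk x)⟩
  · rintro ⟨g', rfl⟩
    change (g' ∘ₗ _) ∘ₗ _ = 0
    rw [LinearMap.comp_assoc, d_hom_comp_d_hom, LinearMap.comp_zero]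

/-- The map of character modules induced by a map of right modules. -/
def leftDual {A B : Type u} [AddCommGroup A] [Module Rᵐᵒᵖ A] [AddCommGroup B] [Module Rᵐᵒᵖ B]
    (p : A →ₗ[Rᵐᵒᵖ] B) : CharacterModule B →ₗ[R] CharacterModule A where
  toFun c := AddMonoidHom.comp c p.toAddMonoidHom
  map_add' _ _ := rfl
  map_smul' r c := by ext x; exact congrArg c (map_smul p (op r) x).symm

/-- Exact complexes of projective modules stay exact after tensoring with modules of finite flat
dimension. -/
lemma IsExactProjectiveComplex.isHomExact_char_of_rightFlatDimLE
    (hP : IsExactProjectiveComplex P) (n : ℕ) : ∀ (A : Type u) [AddCommGroup A] [Module Rᵐᵒᵖ A],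
      RightFlatDimLE R n A → IsHomExact P (CharacterModule A) := by
  induction n with
  | zero => exact fun A _ _ hA => hP.isHomExact_of_injective (injective_char_of_isFlatRight hA)
  | succ n ih =>
    rintro A _ _ ⟨F, _, _, p, hF, hp, hK⟩
    have hF' := isHomExact_iff.1 (hP.isHomExact_of_injective (injective_char_of_isFlatRight hF))
    have hK' := isHomExact_iff.1 (ih _ hK)
    let K := LinearMap.ker p
    have hpinj : Function.Injective (leftDual p) := fun c c' h => by
      ext a
      obtain ⟨x, rfl⟩ := hp a
      exact DFunLike.congr_fun h x
    have hres : Function.Surjective (leftDual K.subtype) := fun c => by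
      obtain ⟨v, hv⟩ := CharacterModule.exists_comp_eq_of_ker_le K.subtype.toAddMonoidHom c
        fun u hu => by
          obtain rfl : u = 0 := Subtype.val_injective hu
          exact map_zero c
      exact ⟨v, by ext u; exact hv u⟩
    have hcomp : ∀ c, leftDual K.subtype (leftDual p c) = 0 := fun c => by
      ext u
      exact (congrArg c u.2).trans (map_zero c)
    refine isHomExact_iff.2 fun i j k hij hjk g hg => ?_
    obtain ⟨h, hh⟩ := hF' i j k hij hjk (leftDual p ∘ₗ g)
      (by rw [LinearMap.comp_assoc, hg, LinearMap.comp_zero])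
    -- Chase in `0 → A⁺ → F⁺ → K⁺ → 0`. The restriction of `h` to `K⁺` is a cocycle, hence a
    -- coboundary from degree `k - 1`. Lifting along projectivity and subtracting corrects `h` so
    -- that it lands in `A⁺`.
    obtain ⟨h', hh'⟩ := hK' j k (k - 1) hjk (by lia) (leftDual K.subtype ∘ₗ h)
      (by rw [LinearMap.comp_assoc, hh]; exact LinearMap.ext fun x => hcomp _)
    have := hP.projective (k - 1)
    obtain ⟨l, hl⟩ := Module.projective_lifting_property (leftDual K.subtype) h' hres
    obtain ⟨w, hw⟩ := exists_comp_eq_of_forall_mem_range hpinj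
      (h - l ∘ₗ (P.d k (k - 1)).hom) fun x => by
        let c := (h - l ∘ₗ (P.d k (k - 1)).hom) x
        have hc : leftDual K.subtype c = 0 := by
          have h1 := LinearMap.congr_fun hh' x
          rw [← hl] at h1
          simp only [c, LinearMap.sub_apply, map_sub]
          exact sub_eq_zero.2 h1.symm
        obtain ⟨v, hv⟩ := CharacterModule.exists_comp_eq_of_ker_le p.toAddMonoidHom c
          fun u hu => DFunLike.congr_fun hc ⟨u, hu⟩
        exact ⟨v, by ext u; exact hv u⟩
    refine ⟨w, LinearMap.ext fun x => hpinj ?_⟩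
    have h1 := LinearMap.congr_fun hw ((P.d j k).hom x)
    have h2 := LinearMap.congr_fun (d_hom_comp_d_hom P j k (k - 1)) x
    have h3 := LinearMap.congr_fun hh x
    simp only [LinearMap.comp_apply, LinearMap.sub_apply, LinearMap.zero_apply] at h1 h2 h3 ⊢
    rw [h1, h2, map_zero, sub_zero, h3]

end Complexes

theorem proposition9 {R : Type u} [Ring R]
    (hfd : ∀ (I : Type u) [AddCommGroup I] [Module Rᵐᵒᵖ I],
      Module.Injective Rᵐᵒᵖ I → ∃ n : ℕ, RightFlatDimLE R n I) :
    GorensteinProjective R = DingProjective R ∧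
      DingProjective R = ProjectivelyCoresolvedGorensteinFlat R := by
  have h₁ : ∀ M, DingProjective R M → GorensteinProjective R M := fun M ⟨P, hP, hF, hM⟩ =>
    ⟨P, hP, fun Q _ _ hQ => hF Q (isFlatLeft_of_projective hQ), hM⟩
  have h₂ : ∀ M, GorensteinProjective R M → ProjectivelyCoresolvedGorensteinFlat R M :=
    fun M ⟨P, hP, _, hM⟩ => ⟨P, hP, fun I _ _ hI =>
      have ⟨n, hn⟩ := hfd I hI
      isTensorExact_iff_isHomExact.2 (hP.isHomExact_char_of_rightFlatDimLE n I hn), hM⟩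
  have h₃ : ∀ M, ProjectivelyCoresolvedGorensteinFlat R M → DingProjective R M :=
    fun M ⟨P, hP, hI, hM⟩ => ⟨P, hP, fun F _ _ hF => hP.isHomExact_of_isFlatLeft hI hF, hM⟩
  exact ⟨funext fun M => propext ⟨fun h => h₃ M (h₂ M h), h₁ M⟩,
    funext fun M => propext ⟨fun h => h₂ M (h₁ M h), h₃ M⟩⟩
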